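/- Let $P$ be a finite, graded, bounded poset with minimum $\hat 0$, maximum $\hat 1$, rank function $\operatorname{rk}$ (with $\operatorname{rk}(\hat 0)=0$), Möbius function $\mu$, and rank $n=\operatorname{rk}(\hat 1)\ge 0$. **Chow polynomials.** For $u\le w$ in $P$ let $\chi_{[u,w]}(x)=\sum_{u\le v\le w}\mu(u,v)\,x^{\operatorname{rk}(w)-\operatorname{rk}(v)}$. Define $\operatorname{H}_{[u,w]}(x)\in\mathbb Z[x]$ by $\operatorname{H}_{[u,u]}=1$ and $\operatorname{H}_{[u,w]}(x)=\sum_{u<v\le w}\frac{\chi_{[u,v]}(x)}{x-1}\operatorname{H}_{[v,w]}(x)$ for $u<w$. The Chow polynomial of $P$ is $\operatorname{H}_P=\operatorname{H}_{[\hat 0,\hat 1]}$, and the augmented Chow polynomial is $\operatorname{H}^{\operatorname{aug}}_P(x)=\sum_{w\in P}x^{\operatorname{rk}(w)}\operatorname{H}_{[w,\hat 1]}(x)$. **Extended $\mathbf{ab}$-index.** Let $\operatorname{Poin}_{[u,w]}(y)=\sum_{u\le v\le w}\mu(u,v)(-y)^{\operatorname{rk}(v)-\operatorname{rk}(u)}$.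 In the ring $\mathbb Z[y]\langle\mathbf a,\mathbf b\rangle$ of polynomials in noncommuting variables $\mathbf a,\mathbf b$, put $$\mathrm{ex}\Psi_P(y,\mathbf a,\mathbf b)=\sum_{\mathcal C}\Big(\prod_{i=1}^{k}\operatorname{Poin}_{[\mathcal C_i,\mathcal C_{i+1}]}(y)\Big)\,w_0w_1\cdots w_{n-1},$$ where the sum ranges over all chains $\mathcal C=\{\mathcal C_1<\dots<\mathcal C_k<\mathcal C_{k+1}=\hat 1\}$ ($k\ge 0$), and $w_j=\mathbf b$ if $j\in\{\operatorname{rk}(\mathcal C_1),\dots,\operatorname{rk}(\mathcal C_k)\}$ and $w_j=\mathbf a-\mathbf b$ otherwise. For $n\ge1$ let $\widetilde{\mathrm{ex}\Psi}_P$ be obtained from $\mathrm{ex}\Psi_P$ by removing the initial letter from every $\mathbf{ab}$-monomial, extended linearly. **Flag vectors.** For a finite set $S$ of ranks let $\alpha(S)$ be the number of maximal chains of the subposet $\{w\in P:\operatorname{rk}(w)\in S\}$, and let $\beta(T)=\sum_{S\subseteq T}(-1)^{\#(T\setminus S)}\alpha(S)$ be the flag $h$-vector. A set $T$ of integers is *isolated*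 if $i\in T$ implies $i+1\notin T$. A polynomial $p\in\mathbb Z[x]$ is *$\gamma$-positive* (with center of symmetry $d/2$) if $p(x)=\sum_{i=0}^{\lfloor d/2\rfloor}\gamma_i\,x^i(1+x)^{d-2i}$ with all $\gamma_i$ nonnegative integers. **Theorem.** 1. $(1-x)^n\operatorname{H}^{\operatorname{aug}}_P(x)=\mathrm{ex}\Psi_P(-x,1,x)$, and, if $n\ge1$, $(1-x)^n\operatorname{H}_P(x)=\widetilde{\mathrm{ex}\Psi}_P(-x,1,x)$. 2. The augmented Chow polynomial has the $\gamma$-expansion $$\operatorname{H}^{\operatorname{aug}}_P(x)=\sum_{T}\beta(T)\,x^{\#T}(1+x)^{n-2\#T},$$ where the sum ranges over all isolated $T\subseteq\{1,\dots,n-1\}$. 3. If $n\ge1$, the Chow polynomial has the $\gamma$-expansion $$\operatorname{H}_P(x)=\sum_{T}\beta(T)\,x^{\#T}(1+x)^{n-1-2\#T},$$ where the sum ranges over all isolated $T\subseteq\{2,\dots,n-1\}$. 4. In particular, if $\beta(T)\ge0$ for all $T\subseteq\{1,\dots,n-1\}$, then $\operatorname{H}^{\operatorname{aug}}_P$ is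 $\gamma$-positive with center of symmetry $n/2$, and, if $n\ge1$, $\operatorname{H}_P$ is $\gamma$-positive with center of symmetry $(n-1)/2$. -/

import Mathlib

open Polynomial

/-! ### Möbius function, characteristic and Poincaré polynomials of intervals

`P` is a finite bounded poset; `GradeMinOrder ℕ P` says that it is graded, with rank function
`grade ℕ`, `grade ℕ ⊥ = 0`. The rank of an interval `[u, w]` is `grade ℕ w - grade ℕ u`. -/

section Intervals

variable {P : Type*} [PartialOrder P] [DecidableEq P] [LocallyFiniteOrder P] [GradeMinOrder ℕ P]

/-- The Poincaré polynomial `∑_{u ≤ v ≤ w} μ(u, v) (-y)^{rk v - rk u}` of the interval `[u, w]`. -/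
noncomputable def poincarePoly (u w : P) : ℤ[X] :=
  ∑ v ∈ Finset.Icc u w, C (IncidenceAlgebra.mu ℤ u v) * (-X) ^ (grade ℕ v - grade ℕ u)

/-- The characteristic polynomial `∑_{u ≤ v ≤ w} μ(u, v) x^{rk w - rk v}` of the interval
`[u, w]`. -/
noncomputable def characteristicPoly (u w : P) : ℤ[X] :=
  ∑ v ∈ Finset.Icc u w, C (IncidenceAlgebra.mu ℤ u v) * X ^ (grade ℕ w - grade ℕ v)

/-- The reduced characteristic polynomial `χ_{[u, w]}(x) / (x - 1)` of an interval with `u < w`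
(the division is exact since `χ_{[u, w]}(1) = 0`). -/
noncomputable def reducedCharacteristicPoly (u w : P) : ℤ[X] :=
  characteristicPoly u w /ₘ (X - C 1)

/-- The Chow polynomial of the interval `[u, w]`: it is `1` if `u = w`, and otherwise
`∑_{u < v ≤ w} (χ_{[u, v]}(x) / (x - 1)) * H_{[v, w]}(x)`. In other words `H = -χ̄⁻¹` in the
incidence algebra, where `χ̄` is `χ / (x - 1)` on nontrivial intervals and `-1` on the diagonal. -/
noncomputable def chowInterval (u w : P) : ℤ[X] :=
  if u = w then 1
  else ∑ v ∈ (Finset.Ioc u w).attach, reducedCharacteristicPoly u v.1 * chowInterval v.1 w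
termination_by (Finset.Icc u w).card
decreasing_by
  have hv := Finset.mem_Ioc.1 v.2
  refine Finset.card_lt_card ⟨Finset.Icc_subset_Icc_left hv.1.le, fun h => ?_⟩
  have := Finset.mem_Icc.1 (h (Finset.left_mem_Icc.2 (hv.1.le.trans hv.2)))
  exact absurd this.1 (not_le_of_gt hv.1)

end Intervals

/-- The Chow polynomial `H_P(x)`. -/
noncomputable def chowPoly (P : Type*) [PartialOrder P] [BoundedOrder P] [DecidableEq P]
    [LocallyFiniteOrder P] [GradeMinOrder ℕ P] : ℤ[X] :=
  chowInterval (⊥ : P) ⊤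

/-- The augmented Chow polynomial `H^aug_P(x) = ∑_{w ∈ P} x^{rk w} H_{[w, 1]}(x)`. -/
noncomputable def augChowPoly (P : Type*) [PartialOrder P] [BoundedOrder P] [Fintype P]
    [DecidableEq P] [LocallyFiniteOrder P] [GradeMinOrder ℕ P] : ℤ[X] :=
  ∑ w : P, X ^ grade ℕ w * chowInterval w ⊤

/-! ### The extended ab-index -/

/-- The two noncommuting variables. -/
inductive ABLetter
  | a
  | b

/-- The ring `ℤ[y]⟨a, b⟩` of polynomials in two noncommuting variables `a`, `b` over `ℤ[y]`,
as the monoid algebra of the free monoid of words in `a`, `b`. -/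
abbrev ABRing : Type := MonoidAlgebra ℤ[X] (FreeMonoid ABLetter)

/-- The variable `a` or `b` as an element of `ℤ[y]⟨a, b⟩`. -/
noncomputable def abVar (l : ABLetter) : ABRing := MonoidAlgebra.of ℤ[X] _ (FreeMonoid.of l)

open Classical in
/-- `wt_S(a, b) = w_0 ⋯ w_{n-1}` with `w_k = b` if `k ∈ S`, and `w_k = a - b` otherwise. -/
noncomputable def abWeight (n : ℕ) (S : Finset ℕ) : ABRing :=
  ((List.range n).map fun k =>
    if k ∈ S then abVar ABLetter.b else abVar ABLetter.a - abVar ABLetter.b).prod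

/-- The map `ι` that removes the initial letter from every ab-monomial. -/
noncomputable def removeInitial (f : ABRing) : ABRing :=
  MonoidAlgebra.mapDomain (fun m => FreeMonoid.ofList (FreeMonoid.toList m).tail) f

/-- The evaluation `f(y, a, b) ↦ f(-x, 1, x)`. -/
noncomputable def abEval : ABRing →+* ℤ[X] :=
  MonoidAlgebra.liftNCRingHom (compRingHom (-X : ℤ[X]))
    (FreeMonoid.lift fun l : ABLetter => ABLetter.casesOn l 1 X) fun _ _ => Commute.all _ _

section ABIndex

variable (P : Type*) [PartialOrder P] [BoundedOrder P] [Fintype P] [DecidableEq P]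
  [LocallyFiniteOrder P] [GradeMinOrder ℕ P]

open Classical in
/-- The chains of `P` that end in the maximum. -/
noncomputable def chainsToTop : Finset (Finset P) :=
  Finset.univ.filter fun c => IsChain (· ≤ ·) (c : Set P) ∧ ⊤ ∈ c

variable {P} in
open Classical in
/-- The chain Poincaré polynomial: the product of the Poincaré polynomials of the intervals
`[u, v]`, for `u < v` consecutive elements of the chain `c`. -/
noncomputable def chainPoincarePoly (c : Finset P) : ℤ[X] :=
  ∏ p ∈ (c ×ˢ c).filter (fun p => p.1 < p.2 ∧ ∀ z ∈ c, ¬ (p.1 < z ∧ z < p.2)),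
    poincarePoly p.1 p.2

/-- The extended ab-index: the sum over all chains `c = {c_1 < ⋯ < c_k < 1}` of
`Poin_{P,c}(y) * wt_{rk c_1, …, rk c_k}(a, b)`. -/
noncomputable def extendedABIndex : ABRing :=
  ∑ c ∈ chainsToTop P,
    chainPoincarePoly c • abWeight (grade ℕ (⊤ : P)) ((c.erase ⊤).image (grade ℕ))

end ABIndex

/-! ### Flag vectors, isolated sets and γ-positivity -/

/-- The flag `f`-vector: `α(S)` is the number of maximal chains of the subposet of `P` of the
elements with rank in `S`. -/
noncomputable def flagF (P : Type*) [PartialOrder P] [GradeMinOrder ℕ P] (S : Finset ℕ) : ℕ :=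
  Nat.card (Flag {w : P // grade ℕ w ∈ S})

/-- The flag `h`-vector `β(T) = ∑_{S ⊆ T} (-1)^{|T \ S|} α(S)`. -/
noncomputable def flagH (P : Type*) [PartialOrder P] [GradeMinOrder ℕ P] (T : Finset ℕ) : ℤ :=
  ∑ S ∈ T.powerset, (-1) ^ (T \ S).card * (flagF P S : ℤ)

/-- The isolated subsets of a finite set `A` of natural numbers: those without two consecutive
elements. -/
def isolatedSubsets (A : Finset ℕ) : Finset (Finset ℕ) :=
  A.powerset.filter fun T => ∀ i ∈ T, i + 1 ∉ T

/-- `p` is γ-positive with center of symmetry `d / 2`. -/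
def IsGammaPositive (d : ℕ) (p : ℤ[X]) : Prop :=
  ∃ γ : ℕ → ℤ, (∀ i, 0 ≤ γ i) ∧
    p = ∑ i ∈ Finset.range (d / 2 + 1), C (γ i) * X ^ i * (1 + X) ^ (d - 2 * i)

/-! In the incidence algebra, `χ = μ · x^rk`, and the definition of `H` says `(χ - x) H = 1 - x`.
Multiplying on the left by `ζ`, and then by the inverse of `x^rk`, gives two recursions:
`sum_Ioc_rank_mul_chowInterval`, which involves only ranks, and `sum_Ioc_poincare_mul_chowInterval`,
which involves the Poincaré polynomials at `y = -x`.

The Poincaré recursion, iterated along chains, yields the specializations: the chains starting at `u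
< ⊤` contribute `(1 - x)^n x H_{[u, 1]}` (`sum_chainTerm_of_lt`). Summing over all `u` gives the
augmented polynomial; stripping the first letter leaves only the chains through `⊥`.

The rank recursion, iterated, writes `H` as a sum over chains from `⊥` to `⊤` of weights that depend
only on the rank set `S`: a gap `k` below the top contributes `x + ⋯ + x^(k-1)`, and the last gap
has an additional `1`. For the augmented polynomial the first gap gains a term `x^k`. `gapWeight`
computes such a weight one rank at a time by a linear action on pairs. Replacing `α(S)` by `∑_{T ⊆
S} β(T)` turns the coefficient of `β(T)` into the sum of the weights of all `S ⊇ T`. In that sum the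
two branches at a rank outside `T` recombine, which leaves a monomial in `x` and `1 + x` if `T` is
isolated and zero otherwise (`upperGapWeight_eq`). -/

set_option linter.unusedSectionVars false

/-! ### Incidence algebra identities and the two recursions for Chow polynomials -/

section ChowRecursion

variable {P : Type*} [PartialOrder P] [DecidableEq P] [LocallyFiniteOrder P] [GradeMinOrder ℕ P]

theorem X_sub_one_mul_reducedCharacteristicPoly {u w : P} (h : u < w) :
    (X - 1) * reducedCharacteristicPoly u w = characteristicPoly u w := by
  have : (X - C 1 : ℤ[X]) * reducedCharacteristicPoly u w = characteristicPoly u w := by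
    refine mul_divByMonic_eq_iff_isRoot.2 ?_
    simp only [IsRoot, characteristicPoly, eval_finsetSum, eval_mul, eval_C, eval_pow, eval_X,
      one_pow, mul_one]
    rw [IncidenceAlgebra.sum_Icc_mu_right, if_neg h.ne]
  simpa using this

theorem chowInterval_self (u : P) : chowInterval u u = 1 := by
  rw [chowInterval, if_pos rfl]

theorem chowInterval_of_lt {u w : P} (h : u < w) :
    chowInterval u w
      = ∑ v ∈ Finset.Ioc u w, reducedCharacteristicPoly u v * chowInterval v w := by
  rw [chowInterval, if_neg h.ne]
  exact Finset.sum_attach (Finset.Ioc u w)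
    (fun v => reducedCharacteristicPoly u v * chowInterval v w)

theorem characteristicPoly_self (u : P) : characteristicPoly u u = 1 := by
  simp [characteristicPoly]

variable (P) in
open scoped Classical in
/-- The Möbius function, with polynomial values. -/
noncomputable def muPoly : IncidenceAlgebra ℤ[X] P :=
  ⟨fun u v => C (IncidenceAlgebra.mu ℤ u v), fun _ _ h => by
    simp [IncidenceAlgebra.apply_eq_zero_of_not_le h]⟩

variable (P) in
open scoped Classical in
/-- The element `x ^ rk` of the incidence algebra. -/
noncomputable def rankZeta : IncidenceAlgebra ℤ[X] P :=
  ⟨fun u v => if u ≤ v then X ^ (grade ℕ v - grade ℕ u) else 0, fun _ _ h => if_neg h⟩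

variable (P) in
open scoped Classical in
/-- The inverse `μ x ^ rk` of `rankZeta`. -/
noncomputable def rankMu : IncidenceAlgebra ℤ[X] P :=
  ⟨fun u v => C (IncidenceAlgebra.mu ℤ u v) * X ^ (grade ℕ v - grade ℕ u), fun _ _ h => by
    simp [IncidenceAlgebra.apply_eq_zero_of_not_le h]⟩

variable (P) in
open scoped Classical in
/-- The Chow polynomials of intervals as an element of the incidence algebra. -/
noncomputable def chowIncidence : IncidenceAlgebra ℤ[X] P :=
  ⟨fun u v => if u ≤ v then chowInterval u v else 0, fun _ _ h => if_neg h⟩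

open scoped Classical in
theorem zeta_mul_muPoly : IncidenceAlgebra.zeta ℤ[X] * muPoly P = 1 := by
  ext u w h : 1
  have := IncidenceAlgebra.sum_Icc_mu_left (𝕜 := ℤ) u w
  have h2 : ∑ v ∈ Finset.Icc u w, IncidenceAlgebra.zeta ℤ[X] u v * muPoly P v w
      = ∑ v ∈ Finset.Icc u w, C (IncidenceAlgebra.mu ℤ v w) := by
    refine Finset.sum_congr rfl fun v hv => ?_
    rw [IncidenceAlgebra.zeta_of_le (Finset.mem_Icc.1 hv).1, one_mul]
    rfl
  rw [IncidenceAlgebra.mul_apply, h2, ← map_sum, this, IncidenceAlgebra.one_apply]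
  split_ifs <;> simp

open scoped Classical in
theorem rankMu_mul_rankZeta : rankMu P * rankZeta P = 1 := by
  ext u w h : 1
  have := IncidenceAlgebra.sum_Icc_mu_right (𝕜 := ℤ) u w
  have h2 : ∑ v ∈ Finset.Icc u w, rankMu P u v * rankZeta P v w
      = ∑ v ∈ Finset.Icc u w, C (IncidenceAlgebra.mu ℤ u v) * X ^ (grade ℕ w - grade ℕ u) := by
    refine Finset.sum_congr rfl fun v hv => ?_
    obtain ⟨h1, h2⟩ := Finset.mem_Icc.1 hv
    have g1 := grade_mono (𝕆 := ℕ) h1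
    have g2 := grade_mono (𝕆 := ℕ) h2
    simp only [rankMu, rankZeta, IncidenceAlgebra.coe_mk, if_pos h2]
    rw [mul_assoc, ← pow_add]
    congr 2
    omega
  rw [IncidenceAlgebra.mul_apply, h2, ← Finset.sum_mul, ← map_sum, this,
    IncidenceAlgebra.one_apply]
  split_ifs with h3
  · simp [h3]
  · simp

theorem muPoly_mul_rankZeta_apply (u w : P) :
    (muPoly P * rankZeta P) u w = characteristicPoly u w := by
  rw [IncidenceAlgebra.mul_apply, characteristicPoly]
  refine Finset.sum_congr rfl fun v hv => ?_
  simp only [muPoly, rankZeta, IncidenceAlgebra.coe_mk, if_pos (Finset.mem_Icc.1 hv).2]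

/-- Off the diagonal `χ - x` is `x - 1` times the reduced characteristic polynomial, and on it `1 -
x`; this is the defining recursion with the term `v = u` moved into the sum. -/
theorem characteristic_mul_chow :
    (muPoly P * rankZeta P - (X : ℤ[X]) • 1) * chowIncidence P = (1 - X : ℤ[X]) • 1 := by
  ext u w h : 1
  rw [IncidenceAlgebra.mul_apply]
  simp only [IncidenceAlgebra.constSMul_apply, IncidenceAlgebra.sub_apply,
    muPoly_mul_rankZeta_apply, IncidenceAlgebra.one_apply, smul_eq_mul]
  rw [← Finset.Ioc_insert_left h, Finset.sum_insert (by simp)]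
  have h1 : ∑ v ∈ Finset.Ioc u w, (characteristicPoly u v - X * if u = v then 1 else 0)
      * chowIncidence P v w
      = (X - 1) * ∑ v ∈ Finset.Ioc u w, reducedCharacteristicPoly u v * chowInterval v w := by
    rw [Finset.mul_sum]
    refine Finset.sum_congr rfl fun v hv => ?_
    obtain ⟨h1, h2⟩ := Finset.mem_Ioc.1 hv
    rw [← X_sub_one_mul_reducedCharacteristicPoly h1]
    simp only [chowIncidence, IncidenceAlgebra.coe_mk, if_pos h2, if_neg h1.ne]
    ring
  rw [h1]
  simp only [chowIncidence, IncidenceAlgebra.coe_mk, if_pos h, characteristicPoly_self]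
  rcases h.eq_or_lt with rfl | h
  · simp [chowInterval_self]
  · rw [chowInterval_of_lt h, if_neg h.ne]
    simp only [if_true]
    ring

open scoped Classical in
theorem rankZeta_sub_mul_chow :
    (rankZeta P - (X : ℤ[X]) • IncidenceAlgebra.zeta ℤ[X]) * chowIncidence P
      = (1 - X : ℤ[X]) • IncidenceAlgebra.zeta ℤ[X] := by
  have := congrArg (IncidenceAlgebra.zeta ℤ[X] * ·) (characteristic_mul_chow (P := P))
  simp only [← mul_assoc, mul_sub, zeta_mul_muPoly, one_mul, mul_smul_comm, mul_one] at this
  exact this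

open scoped Classical in
-- The product `rankMu * ζ` has the Poincaré polynomials at `y = -x` as entries, so this prepares
-- the recursion that matches the extended ab-index.
theorem one_sub_mul_chow :
    (1 - (X : ℤ[X]) • (rankMu P * IncidenceAlgebra.zeta ℤ[X])) * chowIncidence P
      = (1 - X : ℤ[X]) • (rankMu P * IncidenceAlgebra.zeta ℤ[X]) := by
  have := congrArg (rankMu P * ·) (rankZeta_sub_mul_chow (P := P))
  simp only [← mul_assoc, mul_sub, rankMu_mul_rankZeta, mul_smul_comm] at this
  exact this

open scoped Classical in
theorem rankMu_mul_zeta_apply (u w : P) :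
    (rankMu P * IncidenceAlgebra.zeta ℤ[X] : IncidenceAlgebra ℤ[X] P) u w
      = (poincarePoly u w).comp (-X) := by
  rw [IncidenceAlgebra.mul_apply, poincarePoly, Polynomial.sum_comp]
  refine Finset.sum_congr rfl fun v hv => ?_
  rw [IncidenceAlgebra.zeta_of_le (Finset.mem_Icc.1 hv).2]
  simp [rankMu]

/-- The recursion of the Chow polynomials in terms of the ranks of intervals. -/
theorem sum_Ioc_rank_mul_chowInterval {u w : P} (h : u ≤ w) :
    (1 - X) * chowInterval u w
      = (1 - X) + ∑ v ∈ Finset.Ioc u w, (X - X ^ (grade ℕ v - grade ℕ u)) * chowInterval v w := by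
  classical
  have := congrArg (fun f : IncidenceAlgebra ℤ[X] P => f u w) (rankZeta_sub_mul_chow (P := P))
  simp only [IncidenceAlgebra.mul_apply] at this
  simp only [IncidenceAlgebra.constSMul_apply, IncidenceAlgebra.sub_apply, smul_eq_mul,
    IncidenceAlgebra.zeta_of_le h, mul_one] at this
  have h0 : ∑ v ∈ Finset.Ioc u w, (rankZeta P u v - X * IncidenceAlgebra.zeta ℤ[X] u v)
      * chowIncidence P v w
      = - ∑ v ∈ Finset.Ioc u w, (X - X ^ (grade ℕ v - grade ℕ u)) * chowInterval v w := by
    rw [← Finset.sum_neg_distrib]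
    refine Finset.sum_congr rfl fun v hv => ?_
    obtain ⟨h1, h2⟩ := Finset.mem_Ioc.1 hv
    simp only [chowIncidence, rankZeta, IncidenceAlgebra.coe_mk, if_pos h2, if_pos h1.le,
      IncidenceAlgebra.zeta_of_le h1.le]
    ring
  rw [← Finset.Ioc_insert_left h, Finset.sum_insert (by simp), h0] at this
  simp only [chowIncidence, rankZeta, IncidenceAlgebra.coe_mk, if_pos h, le_refl, if_true,
    IncidenceAlgebra.zeta_of_le, Nat.sub_self, pow_zero, mul_one] at this
  linear_combination this

/-- The recursion of the Chow polynomials in terms of the Poincaré polynomials of intervals. -/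
theorem sum_Ioc_poincare_mul_chowInterval {u w : P} (h : u < w) :
    (1 - X) * chowInterval u w
      = (1 - X) * (poincarePoly u w).comp (-X)
        + X * ∑ v ∈ Finset.Ioc u w, (poincarePoly u v).comp (-X) * chowInterval v w := by
  classical
  have := congrArg (fun f : IncidenceAlgebra ℤ[X] P => f u w) (one_sub_mul_chow (P := P))
  simp only [sub_mul, one_mul, smul_mul_assoc] at this
  simp only [IncidenceAlgebra.constSMul_apply, IncidenceAlgebra.sub_apply, smul_eq_mul,
    rankMu_mul_zeta_apply] at this
  rw [IncidenceAlgebra.mul_apply] at this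
  simp only [rankMu_mul_zeta_apply] at this
  have h1 : ∑ v ∈ Finset.Ioc u w, (poincarePoly u v).comp (-X) * chowIncidence P v w
      = ∑ v ∈ Finset.Ioc u w, (poincarePoly u v).comp (-X) * chowInterval v w := by
    refine Finset.sum_congr rfl fun v hv => ?_
    simp only [chowIncidence, IncidenceAlgebra.coe_mk, if_pos (Finset.mem_Ioc.1 hv).2]
  have h2 : (poincarePoly u u).comp (-X) = 1 := by simp [poincarePoly]
  rw [← Finset.Ioc_insert_left h.le, Finset.sum_insert (by simp), h1, h2] at this
  simp only [chowIncidence, IncidenceAlgebra.coe_mk, if_pos h.le] at this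
  linear_combination this

end ChowRecursion

/-! ### Decomposition of chains by their least element -/

section ChainsToTop

variable {P : Type*} [PartialOrder P] [BoundedOrder P] [Fintype P]

open scoped Classical in
/-- The chains of `P` with least element `u` that end in the maximum. -/
noncomputable def chainsFrom (u : P) : Finset (Finset P) :=
  Finset.univ.filter fun c => IsChain (· ≤ ·) (c : Set P) ∧ ⊤ ∈ c ∧ IsLeast (c : Set P) u

theorem mem_chainsFrom {u : P} {c : Finset P} :
    c ∈ chainsFrom u ↔ IsChain (· ≤ ·) (c : Set P) ∧ ⊤ ∈ c ∧ IsLeast (c : Set P) u := by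
  simp [chainsFrom]

theorem exists_isLeast_of_isChain {α : Type*} [PartialOrder α] {c : Finset α}
    (hc : IsChain (· ≤ ·) (c : Set α)) (h : c.Nonempty) : ∃ u, IsLeast (c : Set α) u := by
  obtain ⟨u, hu⟩ := c.exists_minimal h
  refine ⟨u, hu.1, fun v hv => ?_⟩
  rcases hc.total hu.1 hv with h | h
  · exact h
  · exact hu.2 hv h

theorem chainsFrom_top : chainsFrom (⊤ : P) = {{⊤}} := by
  ext c
  rw [mem_chainsFrom, Finset.mem_singleton]
  constructor
  · rintro ⟨-, h1, -, h2⟩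
    ext v
    rw [Finset.mem_singleton]
    exact ⟨fun hv => top_le_iff.1 (h2 hv), fun hv => hv ▸ h1⟩
  · rintro rfl
    simp

theorem notMem_of_mem_chainsFrom {u v : P} {c : Finset P} (h : u < v) (hc : c ∈ chainsFrom v) :
    u ∉ c :=
  fun hu => not_lt_of_ge ((mem_chainsFrom.1 hc).2.2.2 hu) h

variable [DecidableEq P]

theorem insert_mem_chainsFrom {u v : P} {c : Finset P} (h : u < v) (hc : c ∈ chainsFrom v) :
    insert u c ∈ chainsFrom u := by
  obtain ⟨h1, h2, h3⟩ := mem_chainsFrom.1 hc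
  have h4 : ∀ w ∈ c, u ≤ w := fun w hw => h.le.trans (h3.2 hw)
  refine mem_chainsFrom.2 ⟨?_, Finset.mem_insert_of_mem h2, ?_, ?_⟩
  · rw [Finset.coe_insert]
    exact h1.insert fun w hw _ => Or.inl (h4 w hw)
  · simp
  · intro w hw
    rcases Finset.mem_insert.1 hw with rfl | hw
    · exact le_rfl
    · exact h4 w hw

theorem exists_insert_of_mem_chainsFrom {u : P} {c : Finset P} (h : u < ⊤)
    (hc : c ∈ chainsFrom u) : ∃ v, u < v ∧ ∃ d ∈ chainsFrom v, insert u d = c := by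
  obtain ⟨h1, h2, h3⟩ := mem_chainsFrom.1 hc
  have h4 : ⊤ ∈ c.erase u := Finset.mem_erase.2 ⟨h.ne', h2⟩
  have h5 : IsChain (· ≤ ·) ((c.erase u : Finset P) : Set P) :=
    h1.mono (Finset.coe_subset.2 (Finset.erase_subset _ _))
  obtain ⟨v, hv⟩ := exists_isLeast_of_isChain h5 ⟨_, h4⟩
  have h6 := Finset.mem_erase.1 hv.1
  exact ⟨v, lt_of_le_of_ne (h3.2 h6.2) h6.1.symm, _, mem_chainsFrom.2 ⟨h5, h4, hv⟩,
    Finset.insert_erase h3.1⟩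

/-- Removing the least element `u` leaves a nonempty chain, since `u < ⊤`; its new least element `v`
is the outer index. This is the step by which the recursions are iterated. -/
theorem sum_chainsFrom [LocallyFiniteOrder P] {M : Type*} [AddCommMonoid M] {u : P} (h : u < ⊤)
    (f : Finset P → M) :
    ∑ c ∈ chainsFrom u, f c
      = ∑ v ∈ Finset.Ioc u ⊤, ∑ c ∈ chainsFrom v, f (insert u c) := by
  rw [Finset.sum_sigma']
  symm
  refine Finset.sum_bij (fun p _ => insert u p.2) ?_ ?_ ?_ fun _ _ => rfl
  · rintro ⟨v, c⟩ hp
    rw [Finset.mem_sigma] at hp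
    exact insert_mem_chainsFrom (Finset.mem_Ioc.1 hp.1).1 hp.2
  · rintro ⟨v, c⟩ hp ⟨w, d⟩ hq heq
    rw [Finset.mem_sigma] at hp hq
    have h1 := notMem_of_mem_chainsFrom (Finset.mem_Ioc.1 hp.1).1 hp.2
    have h2 := notMem_of_mem_chainsFrom (Finset.mem_Ioc.1 hq.1).1 hq.2
    have h3 : c = d := by
      have := congrArg (fun s => Finset.erase s u) heq
      simpa [Finset.erase_insert h1, Finset.erase_insert h2] using this
    subst h3
    have h4 : v = w := (mem_chainsFrom.1 hp.2).2.2.unique (mem_chainsFrom.1 hq.2).2.2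
    subst h4
    rfl
  · intro c hc
    obtain ⟨v, hv, d, hd, rfl⟩ := exists_insert_of_mem_chainsFrom h hc
    exact ⟨⟨v, d⟩, Finset.mem_sigma.2 ⟨Finset.mem_Ioc.2 ⟨hv, le_top⟩, hd⟩, rfl⟩

variable [LocallyFiniteOrder P] [GradeMinOrder ℕ P]

theorem mem_chainsToTop {c : Finset P} :
    c ∈ chainsToTop P ↔ IsChain (· ≤ ·) (c : Set P) ∧ ⊤ ∈ c := by
  simp [chainsToTop]

theorem sum_chainsToTop {M : Type*} [AddCommMonoid M] (f : Finset P → M) :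
    ∑ c ∈ chainsToTop P, f c = ∑ u : P, ∑ c ∈ chainsFrom u, f c := by
  rw [← Finset.sum_biUnion]
  · refine Finset.sum_congr ?_ fun _ _ => rfl
    ext c
    simp only [mem_chainsToTop, Finset.mem_biUnion, Finset.mem_univ, true_and, mem_chainsFrom]
    constructor
    · rintro ⟨h1, h2⟩
      obtain ⟨u, hu⟩ := exists_isLeast_of_isChain h1 ⟨_, h2⟩
      exact ⟨u, h1, h2, hu⟩
    · rintro ⟨u, h1, h2, -⟩
      exact ⟨h1, h2⟩
  · intro u _ v _ huv
    rw [Function.onFun, Finset.disjoint_left]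
    intro c h1 h2
    exact huv ((mem_chainsFrom.1 h1).2.2.unique (mem_chainsFrom.1 h2).2.2)

end ChainsToTop

/-! ### Weights of rank sets and their sums over supersets -/

section GapWeight

/-- The total weight of the ranks `j + 1, …, j + m + 1` of a chain with rank set `S`: the pair
`(p, q)` turns into `(p, x (p + q))` at a rank outside of `S`, and into
`(x (p + q), -x (p + q))` at a rank in `S`; the last rank is not inspected, and the two
components are added up at the end. -/
noncomputable def gapWeight (S : Finset ℕ) : ℕ → ℕ → ℤ[X] → ℤ[X] → ℤ[X]
  | 0, _, p, q => p + X * (p + q)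
  | m + 1, j, p, q =>
    if j + 1 ∈ S then gapWeight S m (j + 1) (X * (p + q)) (-(X * (p + q)))
    else gapWeight S m (j + 1) p (X * (p + q))

theorem gapWeight_congr {S T : Finset ℕ} (m j : ℕ) (p q : ℤ[X])
    (h : ∀ i, j < i → i ≤ j + m → (i ∈ S ↔ i ∈ T)) :
    gapWeight S m j p q = gapWeight T m j p q := by
  induction m generalizing j p q with
  | zero => rfl
  | succ m ih =>
    simp only [gapWeight, h (j + 1) (by omega) (by omega)]
    rw [ih, ih] <;> exact fun i h1 h2 => h i (by omega) (by omega)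

theorem gapWeight_mul (S : Finset ℕ) (m j : ℕ) (r p q : ℤ[X]) :
    gapWeight S m j (r * p) (r * q) = r * gapWeight S m j p q := by
  induction m generalizing j p q with
  | zero => simp only [gapWeight]; ring
  | succ m ih =>
    simp only [gapWeight, mul_ite, ← ih]
    congr 2 <;> ring

/-- While no rank of `S` is met, `p` stays fixed and `q` evolves by the affine map `q ↦ x (p + q)`.
-/
theorem gapWeight_gap (S : Finset ℕ) (k m j : ℕ) (p q : ℤ[X])
    (h : ∀ i, j < i → i ≤ j + k → i ∉ S) :
    gapWeight S (k + m) j p q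
      = gapWeight S m (j + k) p (X ^ k * q + (∑ i ∈ Finset.range k, X ^ (i + 1)) * p) := by
  induction k generalizing j q with
  | zero => simp
  | succ k ih =>
    rw [show k + 1 + m = k + m + 1 by ring, gapWeight, if_neg (h _ (by omega) (by omega)),
      ih _ _ (fun i h1 h2 => h i (by omega) (by omega)), show j + 1 + k = j + (k + 1) by ring]
    congr 1
    rw [Finset.sum_range_succ]
    ring

/-- At a rank in `S` the pair becomes a multiple of `(1, -1)`, whatever `q` was, so the weight
factors there. With `q = -1` the gap factor is `x + ⋯ + x^(k-1)`; with `q = 0` it is `x + ⋯ + x^k`.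
-/
theorem gapWeight_of_isLeast {S : Finset ℕ} {m j s : ℕ} (q : ℤ[X]) (hjs : j < s)
    (hs : s ≤ j + m) (hS : s ∈ S) (hmin : ∀ i ∈ S, j < i → s ≤ i) :
    gapWeight S m j 1 q
      = (X ^ (s - j) * q + ∑ i ∈ Finset.range (s - j), X ^ (i + 1))
        * gapWeight S (j + m - s) s 1 (-1) := by
  -- `k` counts the ranks strictly between `j` and `s`, and `l` below the inspected ranks after `s`.
  obtain ⟨k, rfl⟩ : ∃ k, s = j + k + 1 := ⟨s - j - 1, by omega⟩
  obtain ⟨l, rfl⟩ : ∃ l, m = k + (l + 1) := ⟨m - k - 1, by omega⟩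
  rw [gapWeight_gap, gapWeight, if_pos hS, ← gapWeight_mul,
    show j + (k + (l + 1)) - (j + k + 1) = l by omega,
    show j + k + 1 - j = k + 1 by omega, Finset.sum_range_succ']
  · have : (∑ i ∈ Finset.range k, X ^ (i + 1 + 1) : ℤ[X])
        = X * ∑ i ∈ Finset.range k, X ^ (i + 1) := by
      rw [Finset.mul_sum]
      exact Finset.sum_congr rfl fun _ _ => by ring
    rw [this]
    congr 1 <;> ring
  · intro i h1 h2 h3
    have := hmin i h3 h1
    omega

theorem gapWeight_of_empty {S : Finset ℕ} {m j : ℕ} (q : ℤ[X])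
    (h : ∀ i, j < i → i ≤ j + m → i ∉ S) :
    gapWeight S m j 1 q = 1 + (X ^ (m + 1) * q + ∑ i ∈ Finset.range (m + 1), X ^ (i + 1)) := by
  have := gapWeight_gap S m 0 j 1 q h
  rw [add_zero] at this
  rw [this, gapWeight, Finset.sum_range_succ']
  have : (∑ i ∈ Finset.range m, X ^ (i + 1 + 1) : ℤ[X])
      = X * ∑ i ∈ Finset.range m, X ^ (i + 1) := by
    rw [Finset.mul_sum]
    exact Finset.sum_congr rfl fun _ _ => by ring
  rw [this]
  ring

/-- The sum of the weights of all sets `S` of ranks with `T ⊆ S`. -/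
noncomputable def upperGapWeight (T : Finset ℕ) (m j : ℕ) (p q : ℤ[X]) : ℤ[X] :=
  ∑ S ∈ (Finset.Ioc j (j + m)).powerset with T ⊆ S, gapWeight S m j p q

theorem sum_filter_superset_insert {M : Type*} [AddCommMonoid M] {α : Type*} [DecidableEq α]
    {A T : Finset α} {a : α} (ha : a ∉ A) (f : Finset α → M) :
    ∑ S ∈ (insert a A).powerset with T ⊆ S, f S
      = (if a ∈ T then 0 else ∑ S ∈ A.powerset with T.erase a ⊆ S, f S)
        + ∑ S ∈ A.powerset with T.erase a ⊆ S, f (insert a S) := by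
  rw [Finset.sum_filter, Finset.sum_powerset_insert ha, Finset.sum_filter, Finset.sum_filter]
  congr 1
  · split_ifs with h
    · refine Finset.sum_eq_zero fun S hS => if_neg fun h2 => ha ?_
      exact Finset.mem_powerset.1 hS (h2 h)
    · rw [Finset.erase_eq_of_notMem h]
  · simp only [Finset.subset_insert_iff]

theorem upperGapWeight_zero {T : Finset ℕ} {j : ℕ} (hT : T ⊆ Finset.Ioc j j) (p q : ℤ[X]) :
    upperGapWeight T 0 j p q = p + X * (p + q) := by
  have : T = ∅ := by simpa using hT
  subst this
  simp [upperGapWeight, gapWeight]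

theorem upperGapWeight_succ (T : Finset ℕ) (m j : ℕ) (p q : ℤ[X]) :
    upperGapWeight T (m + 1) j p q
      = (if j + 1 ∈ T then 0
          else upperGapWeight (T.erase (j + 1)) m (j + 1) p (X * (p + q)))
        + upperGapWeight (T.erase (j + 1)) m (j + 1) (X * (p + q)) (-(X * (p + q))) := by
  have h1 : Finset.Ioc j (j + (m + 1)) = insert (j + 1) (Finset.Ioc (j + 1) (j + 1 + m)) := by
    ext i
    simp only [Finset.mem_Ioc, Finset.mem_insert]
    omega
  rw [upperGapWeight, h1, sum_filter_superset_insert (by simp)]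
  have h2 : ∀ S ∈ (Finset.Ioc (j + 1) (j + 1 + m)).powerset, j + 1 ∉ S := by
    intro S hS h
    simpa using Finset.mem_powerset.1 hS h
  congr 1
  · split_ifs with h
    · rfl
    · refine Finset.sum_congr rfl fun S hS => ?_
      rw [gapWeight, if_neg (h2 S (Finset.mem_filter.1 hS).1)]
  · refine Finset.sum_congr rfl fun S hS => ?_
    rw [gapWeight, if_pos (Finset.mem_insert_self _ _)]
    refine gapWeight_congr _ _ _ _ fun i hi _ => ?_
    rw [Finset.mem_insert, or_iff_right (by omega)]

/-- Linearity in the pair is what allows the branches with and without a given rank to be merged. -/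
theorem upperGapWeight_add (T : Finset ℕ) (m j : ℕ) (p q p' q' : ℤ[X]) :
    upperGapWeight T m j (p + p') (q + q')
      = upperGapWeight T m j p q + upperGapWeight T m j p' q' := by
  have h : ∀ (S : Finset ℕ), gapWeight S m j (p + p') (q + q')
      = gapWeight S m j p q + gapWeight S m j p' q' := by
    intro S
    clear T
    induction m generalizing j p q p' q' with
    | zero => simp only [gapWeight]; ring
    | succ m ih =>
      simp only [gapWeight]
      split_ifs
      · rw [← ih]; congr 1 <;> ring
      · rw [← ih]; congr 1; ring
  rw [upperGapWeight, upperGapWeight, upperGapWeight, ← Finset.sum_add_distrib]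
  exact Finset.sum_congr rfl fun S _ => h S

/-- At a rank outside `T` the two branches add up to `(p + x (p + q), 0)`: the pair `(p, 0)` becomes
`((1 + x) p, 0)`, and `(p, -p)` becomes `(p, 0)`. At a rank in `T`, `(p, 0)` becomes `(x p, -x p)`,
while `(p, -p)` dies; hence consecutive ranks in `T` give zero. Each element of `T` thus trades two
factors `1 + x` for one `x`. The power of `1 + x` on the left avoids truncated exponents. -/
theorem upperGapWeight_eq {T : Finset ℕ} (m j : ℕ) (hT : T ⊆ Finset.Ioc j (j + m)) (p : ℤ[X]) :
    (1 + X) ^ (2 * T.card) * upperGapWeight T m j p 0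
        = (if ∀ i ∈ T, i + 1 ∉ T then p * X ^ T.card * (1 + X) ^ (m + 1) else 0) ∧
    (1 + X) ^ (2 * T.card) * upperGapWeight T m j p (-p)
        = (if (∀ i ∈ T, i + 1 ∉ T) ∧ j + 1 ∉ T then p * X ^ T.card * (1 + X) ^ m else 0) := by
  induction m generalizing T j p with
  | zero =>
    have h : T = ∅ := by simpa using hT
    subst h
    rw [upperGapWeight_zero (by simp), upperGapWeight_zero (by simp)]
    simp
    ring
  | succ m ih =>
    have hT' : T.erase (j + 1) ⊆ Finset.Ioc (j + 1) (j + 1 + m) := by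
      intro i hi
      have h1 := Finset.mem_erase.1 hi
      have h2 := Finset.mem_Ioc.1 (hT h1.2)
      rw [Finset.mem_Ioc]
      omega
    -- Deleting `j + 1` from `T` then destroys no adjacency except that with `j + 2`.
    have hj : j ∉ T := fun h => by simpa using hT h
    rw [upperGapWeight_succ, upperGapWeight_succ]
    have hz : upperGapWeight (T.erase (j + 1)) m (j + 1) 0 0 = 0 := by
      have := upperGapWeight_add (T.erase (j + 1)) m (j + 1) 0 0 0 0
      simpa using this
    by_cases h : j + 1 ∈ T
    · have hcard : T.card = (T.erase (j + 1)).card + 1 := (Finset.card_erase_add_one h).symm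
      have hiso : ((∀ i ∈ T.erase (j + 1), i + 1 ∉ T.erase (j + 1)) ∧
          j + 1 + 1 ∉ T.erase (j + 1)) ↔ ∀ i ∈ T, i + 1 ∉ T := by
        simp only [Finset.mem_erase]
        constructor
        · rintro ⟨h1, h2⟩ i hi h3
          by_cases h4 : i = j + 1
          · subst h4
            exact h2 ⟨by omega, h3⟩
          · refine h1 i ⟨h4, hi⟩ ⟨fun h5 => hj ?_, h3⟩
            obtain rfl : i = j := by omega
            exact hi
        · intro h1
          exact ⟨fun i hi h2 => h1 i hi.2 h2.2, fun h2 => h1 _ h h2.2⟩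
      have h1 := (ih (j + 1) hT' (X * (p + 0))).2
      simp only [add_neg_cancel, mul_zero, neg_zero, hz, hiso, h, not_true, and_false, if_true,
        if_false, zero_add, add_zero] at h1 ⊢
      refine ⟨?_, trivial⟩
      rw [hcard, mul_add, pow_add, mul_right_comm, h1]
      split_ifs
      · ring
      · ring
    · rw [Finset.erase_eq_of_notMem h] at hT' hz ⊢
      simp only [add_neg_cancel, mul_zero, neg_zero, hz, add_zero, h, not_false_iff, and_true,
        if_false]
      rw [← upperGapWeight_add, (ih (j + 1) hT' p).1]
      refine ⟨?_, rfl⟩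
      rw [show p + X * p = p * (1 + X) by ring, add_neg_cancel, (ih (j + 1) hT' _).1]
      split_ifs
      · ring
      · rfl

/-- An isolated `T` and its shift `T + 1` are disjoint subsets of `[a, b + 1]`. -/
theorem two_mul_card_le_of_isolated {a b : ℕ} {T : Finset ℕ} (hT : T ⊆ Finset.Icc a b)
    (h : ∀ i ∈ T, i + 1 ∉ T) : 2 * T.card ≤ b + 2 - a := by
  have h1 : Disjoint T (T.image (· + 1)) := by
    rw [Finset.disjoint_left]
    intro i hi h2
    obtain ⟨k, hk, rfl⟩ := Finset.mem_image.1 h2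
    exact h k hk hi
  have h2 : T ∪ T.image (· + 1) ⊆ Finset.Icc a (b + 1) := by
    intro i hi
    rcases Finset.mem_union.1 hi with hi | hi
    · have := Finset.mem_Icc.1 (hT hi)
      rw [Finset.mem_Icc]; omega
    · obtain ⟨k, hk, rfl⟩ := Finset.mem_image.1 hi
      have := Finset.mem_Icc.1 (hT hk)
      rw [Finset.mem_Icc]; omega
  have h3 := Finset.card_le_card h2
  rw [Finset.card_union_of_disjoint h1, Finset.card_image_of_injective _ (add_left_injective 1),
    Nat.card_Icc] at h3
  omega

theorem upperGapWeight_one_zero {T : Finset ℕ} (m : ℕ) (hT : T ⊆ Finset.Icc 1 m) :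
    upperGapWeight T m 0 1 0
      = if ∀ i ∈ T, i + 1 ∉ T then X ^ T.card * (1 + X) ^ (m + 1 - 2 * T.card) else 0 := by
  have h0 : (1 + X : ℤ[X]) ≠ 0 := by
    rw [add_comm, ← C_1]; exact X_add_C_ne_zero 1
  refine mul_left_cancel₀ (pow_ne_zero (2 * T.card) h0) ?_
  rw [(upperGapWeight_eq m 0 (by rwa [zero_add]) 1).1, mul_ite, mul_zero]
  split_ifs with h
  · have := two_mul_card_le_of_isolated hT h
    rw [mul_left_comm, ← pow_add, one_mul, Nat.add_sub_cancel' (by omega)]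
  · rfl

theorem upperGapWeight_one_neg_one {T : Finset ℕ} (m : ℕ) (hT : T ⊆ Finset.Icc 1 m) :
    upperGapWeight T m 0 1 (-1)
      = if (∀ i ∈ T, i + 1 ∉ T) ∧ 1 ∉ T then X ^ T.card * (1 + X) ^ (m - 2 * T.card) else 0 := by
  have h0 : (1 + X : ℤ[X]) ≠ 0 := by
    rw [add_comm, ← C_1]; exact X_add_C_ne_zero 1
  refine mul_left_cancel₀ (pow_ne_zero (2 * T.card) h0) ?_
  rw [(upperGapWeight_eq m 0 (by rwa [zero_add]) 1).2, mul_ite, mul_zero]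
  simp only [zero_add]
  split_ifs with h
  · have hT2 : T ⊆ Finset.Icc 2 m := by
      intro i hi
      have h1 := Finset.mem_Icc.1 (hT hi)
      have h2 : i ≠ 1 := fun h3 => h.2 (h3 ▸ hi)
      rw [Finset.mem_Icc]; omega
    have := two_mul_card_le_of_isolated hT2 h.1
    rw [mul_left_comm, ← pow_add, one_mul, Nat.add_sub_cancel' (by omega)]
  · rfl

end GapWeight

/-! ### Evaluation and removal of the initial letter in the ab-ring -/

section ABEvaluation

theorem abEval_abVar_a : abEval (abVar ABLetter.a) = 1 := by
  simp [abEval, abVar]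

theorem abEval_abVar_b : abEval (abVar ABLetter.b) = X := by
  simp [abEval, abVar]

theorem abEval_smul (p : ℤ[X]) (f : ABRing) : abEval (p • f) = p.comp (-X) * abEval f := by
  rw [← mul_one (p.comp _), ← one_mul f, ← smul_mul_assoc, map_mul, MonoidAlgebra.one_def,
    MonoidAlgebra.smul_single]
  simp [abEval]

theorem abEval_abWeight (n : ℕ) (S : Finset ℕ) :
    abEval (abWeight n S) = ∏ k ∈ Finset.range n, if k ∈ S then X else 1 - X := by
  rw [abWeight, map_list_prod, List.map_map]
  have h : ∀ f : ℕ → ℤ[X], ((List.range n).map f).prod = ∏ k ∈ Finset.range n, f k := by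
    intro f
    induction n with
    | zero => simp
    | succ n ih => rw [List.prod_range_succ, Finset.prod_range_succ, ih]
  rw [h]
  refine Finset.prod_congr rfl fun k _ => ?_
  simp only [Function.comp_apply]
  split_ifs
  · exact abEval_abVar_b
  · rw [map_sub, abEval_abVar_a, abEval_abVar_b]

theorem removeInitial_add (f g : ABRing) :
    removeInitial (f + g) = removeInitial f + removeInitial g :=
  MonoidAlgebra.mapDomain_add _ _ _

/-- Removing initial letters as an additive homomorphism. -/
noncomputable def removeInitialHom : ABRing →+ ABRing :=
  AddMonoidHom.mk' removeInitial removeInitial_add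

theorem removeInitial_abVar_mul (l : ABLetter) (f : ABRing) :
    removeInitial (abVar l * f) = f := by
  induction f using MonoidAlgebra.induction_linear with
  | zero => simp [removeInitial]
  | add f g hf hg => rw [mul_add, removeInitial_add, hf, hg]
  | single m r =>
    simp [removeInitial, abVar]

theorem removeInitial_smul (p : ℤ[X]) (f : ABRing) :
    removeInitial (p • f) = p • removeInitial f := by
  simp [removeInitial]

/-- An initial `b` is stripped, and the factor `x` restores its value; an initial `a - b` is killed,
because `a` and `b` leave the same word behind. -/
theorem removeInitial_abWeight (n : ℕ) (S : Finset ℕ) :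
    X * abEval (removeInitial (abWeight (n + 1) S))
      = if 0 ∈ S then abEval (abWeight (n + 1) S) else 0 := by
  classical
  have h : ∃ g : ABRing, abWeight (n + 1) S
      = (if 0 ∈ S then abVar ABLetter.b else abVar ABLetter.a - abVar ABLetter.b) * g := by
    rw [abWeight, List.range_succ_eq_map, List.map_cons, List.prod_cons]
    exact ⟨_, rfl⟩
  obtain ⟨g, hg⟩ := h
  rw [hg]
  split_ifs
  · rw [removeInitial_abVar_mul, map_mul, abEval_abVar_b]
  · have : removeInitial ((abVar ABLetter.a - abVar ABLetter.b) * g) = 0 := by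
      have := removeInitial_add ((abVar ABLetter.a - abVar ABLetter.b) * g) (abVar ABLetter.b * g)
      rw [← add_mul, sub_add_cancel, removeInitial_abVar_mul, removeInitial_abVar_mul] at this
      exact right_eq_add.1 this |>.symm ▸ rfl
    rw [this, map_zero, mul_zero]

end ABEvaluation

/-! ### The specializations of the extended ab-index -/

section ChainPoincare

variable {P : Type*} [PartialOrder P] [BoundedOrder P] [Fintype P] [DecidableEq P]
  [LocallyFiniteOrder P] [GradeMinOrder ℕ P]

theorem chainPoincarePoly_singleton (u : P) : chainPoincarePoly {u} = 1 := by
  rw [chainPoincarePoly]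
  refine Finset.prod_eq_one fun p hp => ?_
  simp only [Finset.mem_filter, Finset.mem_product, Finset.mem_singleton] at hp
  exact absurd hp.2.1 (by simp [hp.1.1, hp.1.2])

/-- The only new consecutive pair is `(u, v)`, as `v` is the least element of `c`. -/
theorem chainPoincarePoly_insert {u v : P} {c : Finset P} (h : u < v) (hc : c ∈ chainsFrom v) :
    chainPoincarePoly (insert u c) = poincarePoly u v * chainPoincarePoly c := by
  classical
  obtain ⟨-, -, hv, hmin⟩ := mem_chainsFrom.1 hc
  have hu := notMem_of_mem_chainsFrom h hc
  rw [chainPoincarePoly, chainPoincarePoly]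
  rw [← Finset.prod_insert (f := fun p : P × P => poincarePoly p.1 p.2) (a := (u, v))]
  · refine Finset.prod_congr ?_ fun _ _ => rfl
    ext ⟨a, b⟩
    simp only [Finset.mem_filter, Finset.mem_product, Finset.mem_insert, Prod.mk.injEq]
    constructor
    · rintro ⟨⟨ha, hb⟩, hab, hz⟩
      have hb' : b ∈ c := by
        rcases hb with rfl | hb
        · rcases ha with rfl | ha
          · exact absurd hab (lt_irrefl _)
          · exact absurd (hab.trans h) (not_lt_of_ge (hmin ha))
        · exact hb
      rcases ha with rfl | ha
      · left
        refine ⟨rfl, ?_⟩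
        by_contra hne
        exact hz v (Or.inr hv) ⟨h, lt_of_le_of_ne (hmin hb') (Ne.symm hne)⟩
      · exact Or.inr ⟨⟨ha, hb'⟩, hab, fun z hzc => hz z (Or.inr hzc)⟩
    · rintro (⟨rfl, rfl⟩ | ⟨⟨ha, hb⟩, hab, hz⟩)
      · refine ⟨⟨Or.inl rfl, Or.inr hv⟩, h, ?_⟩
        rintro z (rfl | hz) ⟨h1, h2⟩
        · exact lt_irrefl _ h1
        · exact not_lt_of_ge (hmin hz) h2
      · refine ⟨⟨Or.inr ha, Or.inr hb⟩, hab, ?_⟩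
        rintro z (rfl | hzc) ⟨h1, h2⟩
        · exact absurd (h1.trans h) (not_lt_of_ge (hmin ha))
        · exact hz z hzc ⟨h1, h2⟩
  · simp [hu]

/-- The evaluation of the summand of the extended ab-index at a chain. -/
noncomputable def chainTerm (c : Finset P) : ℤ[X] :=
  (chainPoincarePoly c).comp (-X)
    * ∏ k ∈ Finset.range (grade ℕ (⊤ : P)), if k ∈ (c.erase ⊤).image (grade ℕ) then X else 1 - X

theorem abEval_smul_abWeight (c : Finset P) :
    abEval (chainPoincarePoly c • abWeight (grade ℕ (⊤ : P)) ((c.erase ⊤).image (grade ℕ)))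
      = chainTerm c := by
  rw [abEval_smul, abEval_abWeight, chainTerm]

/-- Inserting `u` changes the letter at its rank from `a - b`, of value `1 - x`, to `b`, of value
`x`. -/
theorem chainTerm_insert {u v : P} {c : Finset P} (h : u < v) (hc : c ∈ chainsFrom v) :
    (1 - X) * chainTerm (insert u c) = X * ((poincarePoly u v).comp (-X) * chainTerm c) := by
  obtain ⟨-, -, hv, hmin⟩ := mem_chainsFrom.1 hc
  have hu : u < ⊤ := h.trans_le le_top
  rw [chainTerm, chainTerm, chainPoincarePoly_insert h hc, mul_comp,
    Finset.erase_insert_of_ne hu.ne, Finset.image_insert]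
  have hgu : grade ℕ u ∈ Finset.range (grade ℕ (⊤ : P)) :=
    Finset.mem_range.2 (grade_strictMono hu)
  have hnot : grade ℕ u ∉ (c.erase ⊤).image (grade ℕ) := by
    intro h1
    obtain ⟨w, hw, hw2⟩ := Finset.mem_image.1 h1
    exact (grade_strictMono (𝕆 := ℕ) (h.trans_le (hmin (Finset.mem_of_mem_erase hw)))).ne' hw2
  rw [← Finset.mul_prod_erase _ _ hgu, ← Finset.mul_prod_erase _ _ hgu, if_neg hnot,
    if_pos (Finset.mem_insert_self _ _)]
  have : ∏ k ∈ (Finset.range (grade ℕ (⊤ : P))).erase (grade ℕ u),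
        (if k ∈ insert (grade ℕ u) ((c.erase ⊤).image (grade ℕ)) then X else 1 - X : ℤ[X])
      = ∏ k ∈ (Finset.range (grade ℕ (⊤ : P))).erase (grade ℕ u),
        (if k ∈ (c.erase ⊤).image (grade ℕ) then X else 1 - X) := by
    refine Finset.prod_congr rfl fun k hk => ?_
    simp only [Finset.mem_insert, (Finset.mem_erase.1 hk).1, false_or]
  rw [this]
  ring

theorem one_sub_X_ne_zero : (1 - X : ℤ[X]) ≠ 0 := by
  rw [← neg_sub, neg_ne_zero, ← C_1]
  exact X_sub_C_ne_zero 1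

theorem sum_chainTerm_top :
    ∑ c ∈ chainsFrom (⊤ : P), chainTerm c = (1 - X) ^ grade ℕ (⊤ : P) := by
  simp [chainsFrom_top, chainTerm, chainPoincarePoly_singleton]

/-- Downward induction from `⊤`: both sides satisfy the Poincaré recursion after multiplication by
`1 - x`. -/
theorem sum_chainTerm_of_lt {u : P} (h : u < ⊤) :
    ∑ c ∈ chainsFrom u, chainTerm c
      = (1 - X) ^ grade ℕ (⊤ : P) * (X * chowInterval u ⊤) := by
  induction u using WellFoundedGT.induction with
  | ind u ih =>
  refine mul_left_cancel₀ one_sub_X_ne_zero ?_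
  have h1 : (1 - X) * ∑ c ∈ chainsFrom u, chainTerm c
      = ∑ v ∈ Finset.Ioc u ⊤,
        X * ((poincarePoly u v).comp (-X) * ∑ c ∈ chainsFrom v, chainTerm c) := by
    rw [sum_chainsFrom h, Finset.mul_sum]
    refine Finset.sum_congr rfl fun v hv => ?_
    rw [Finset.mul_sum, Finset.mul_sum, Finset.mul_sum]
    exact Finset.sum_congr rfl fun c hc => chainTerm_insert (Finset.mem_Ioc.1 hv).1 hc
  have h2 := sum_Ioc_poincare_mul_chowInterval h
  rw [h1, mul_left_comm, mul_left_comm (1 - X) X, h2]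
  -- The term `v = ⊤` is separated because the chain `{⊤}` contributes `(1 - x)^n` without the
  -- factor `x`.
  rw [← Finset.insert_erase (Finset.mem_Ioc.2 ⟨h, le_rfl⟩), Finset.sum_insert (by simp),
    Finset.sum_insert (by simp), sum_chainTerm_top, chowInterval_self]
  have h3 : ∑ v ∈ (Finset.Ioc u ⊤).erase ⊤,
        X * ((poincarePoly u v).comp (-X) * ∑ c ∈ chainsFrom v, chainTerm c)
      = X * (1 - X) ^ grade ℕ (⊤ : P) * X *
        ∑ v ∈ (Finset.Ioc u ⊤).erase ⊤, (poincarePoly u v).comp (-X) * chowInterval v ⊤ := by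
    rw [Finset.mul_sum]
    refine Finset.sum_congr rfl fun v hv => ?_
    have hv' := Finset.mem_erase.1 hv
    rw [ih v (Finset.mem_Ioc.1 hv'.2).1 (lt_top_iff_ne_top.2 hv'.1)]
    ring
  rw [h3]
  ring

/-- The rank recursion at `⊥` trades the weights `x^rk` for a uniform `x`, the shape in which chain
sums appear. -/
theorem augChowPoly_eq_sum_chowInterval :
    augChowPoly P = 1 + X * ∑ w ∈ Finset.univ.erase (⊤ : P), chowInterval w ⊤ := by
  have h1 := sum_Ioc_rank_mul_chowInterval (bot_le : (⊥ : P) ≤ ⊤)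
  have h2 : ∀ f : P → ℤ[X], ∑ w : P, f w = f ⊥ + ∑ w ∈ Finset.Ioc ⊥ ⊤, f w := by
    intro f
    rw [← Finset.sum_insert (by simp), Finset.Ioc_insert_left bot_le]
    refine Finset.sum_congr ?_ fun _ _ => rfl
    ext; simp
  have h3 : ∀ w : P, (X - X ^ (grade ℕ w - grade ℕ (⊥ : P))) * chowInterval w ⊤
      = X * chowInterval w ⊤ - X ^ grade ℕ w * chowInterval w ⊤ := by
    intro w
    rw [grade_bot, bot_eq_zero, Nat.sub_zero, sub_mul]
  have h4 := Finset.add_sum_erase Finset.univ (fun w : P => chowInterval w ⊤)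
    (Finset.mem_univ ⊤)
  rw [h2] at h4
  simp only [h3, Finset.sum_sub_distrib, ← Finset.mul_sum] at h1
  rw [augChowPoly, h2, grade_bot, bot_eq_zero, pow_zero]
  simp only [chowInterval_self] at h4
  linear_combination h1 - X * h4

theorem one_sub_pow_mul_augChowPoly :
    (1 - X) ^ grade ℕ (⊤ : P) * augChowPoly P = abEval (extendedABIndex P) := by
  rw [extendedABIndex, map_sum]
  simp only [abEval_smul_abWeight]
  rw [sum_chainsToTop, ← Finset.add_sum_erase _ _ (Finset.mem_univ ⊤), sum_chainTerm_top,
    augChowPoly_eq_sum_chowInterval, Finset.mul_sum, mul_add, mul_one, Finset.mul_sum]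
  congr 1
  refine Finset.sum_congr rfl fun w hw => ?_
  rw [sum_chainTerm_of_lt (lt_top_iff_ne_top.2 (Finset.mem_erase.1 hw).1)]

theorem bot_lt_top_of_one_le_grade (h : 1 ≤ grade ℕ (⊤ : P)) : (⊥ : P) < ⊤ := by
  rw [bot_lt_iff_ne_bot]
  intro h1
  rw [h1, grade_bot] at h
  exact absurd h (by simp)

theorem one_sub_pow_mul_chowPoly (h : 1 ≤ grade ℕ (⊤ : P)) :
    (1 - X) ^ grade ℕ (⊤ : P) * chowPoly P = abEval (removeInitial (extendedABIndex P)) := by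
  have hbt := bot_lt_top_of_one_le_grade h
  -- The factor `x` stands for the removed initial `b`; the chains with that letter are those
  -- containing `⊥`.
  refine mul_left_cancel₀ (X_ne_zero (R := ℤ)) ?_
  have h1 : removeInitial (extendedABIndex P) = ∑ c ∈ chainsToTop P, chainPoincarePoly c •
      removeInitial (abWeight (grade ℕ (⊤ : P)) ((c.erase ⊤).image (grade ℕ))) := by
    have := map_sum removeInitialHom (fun c => chainPoincarePoly c •
      abWeight (grade ℕ (⊤ : P)) ((c.erase ⊤).image (grade ℕ))) (chainsToTop P)
    refine this.trans (Finset.sum_congr rfl fun c _ => removeInitial_smul _ _)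
  obtain ⟨n, hn⟩ := Nat.exists_eq_succ_of_ne_zero (by omega : grade ℕ (⊤ : P) ≠ 0)
  have h2 : ∀ u : P, ∀ c ∈ chainsFrom u, X * abEval (chainPoincarePoly c •
      removeInitial (abWeight (grade ℕ (⊤ : P)) ((c.erase ⊤).image (grade ℕ))))
      = if u = ⊥ then chainTerm c else 0 := by
    intro u c hc
    have hmem : 0 ∈ (c.erase ⊤).image (grade ℕ) ↔ u = ⊥ := by
      obtain ⟨-, -, hu, hmin⟩ := mem_chainsFrom.1 hc
      constructor
      · intro h0
        obtain ⟨w, hw, hw2⟩ := Finset.mem_image.1 h0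
        have h3 : grade ℕ u ≤ 0 := hw2 ▸ grade_mono (hmin (Finset.mem_of_mem_erase hw))
        have h4 : IsMin (grade ℕ u) := fun _ _ => h3.trans (Nat.zero_le _)
        exact (isMin_grade_iff.1 h4).eq_bot
      · rintro rfl
        exact Finset.mem_image.2 ⟨⊥, Finset.mem_erase.2 ⟨hbt.ne, hu⟩, grade_bot⟩
    rw [← abEval_smul_abWeight, abEval_smul, abEval_smul, mul_left_comm, hn, Nat.succ_eq_add_one,
      removeInitial_abWeight]
    simp only [hmem, mul_ite, mul_zero]
  rw [h1, map_sum, Finset.mul_sum, sum_chainsToTop, Finset.sum_eq_single ⊥]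
  · rw [Finset.sum_congr rfl (h2 ⊥)]
    simp only [if_true]
    rw [sum_chainTerm_of_lt hbt, chowPoly]
    ring
  · intro u _ hu
    refine Finset.sum_eq_zero fun c hc => ?_
    rw [h2 u c hc, if_neg hu]
  · simp

end ChainPoincare

/-! ### Chow polynomials as sums of gap weights over chains -/

section GapExpansion

variable {P : Type*} [PartialOrder P] [BoundedOrder P] [Fintype P] [DecidableEq P]
  [LocallyFiniteOrder P] [GradeMinOrder ℕ P]

theorem gapWeight_insert_top {u : P} (h : u < ⊤) (q : ℤ[X]) :
    gapWeight ((insert u {⊤} : Finset P).image (grade ℕ)) (grade ℕ (⊤ : P) - 1 - grade ℕ u)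
        (grade ℕ u) 1 q
      = 1 + (X ^ (grade ℕ (⊤ : P) - grade ℕ u) * q
        + ∑ i ∈ Finset.range (grade ℕ (⊤ : P) - grade ℕ u), X ^ (i + 1)) := by
  have hlt : grade ℕ u < grade ℕ (⊤ : P) := grade_strictMono h
  rw [gapWeight_of_empty, show grade ℕ (⊤ : P) - 1 - grade ℕ u + 1
    = grade ℕ (⊤ : P) - grade ℕ u by omega]
  intro i h1 h2
  simp only [Finset.image_insert, Finset.image_singleton, Finset.mem_insert,
    Finset.mem_singleton]
  omega

theorem gapWeight_insert {u v : P} {c : Finset P} (h : u < v) (hv : v < ⊤)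
    (hc : c ∈ chainsFrom v) (q : ℤ[X]) :
    gapWeight ((insert u c).image (grade ℕ)) (grade ℕ (⊤ : P) - 1 - grade ℕ u) (grade ℕ u) 1 q
      = (X ^ (grade ℕ v - grade ℕ u) * q
          + ∑ i ∈ Finset.range (grade ℕ v - grade ℕ u), X ^ (i + 1))
        * gapWeight (c.image (grade ℕ)) (grade ℕ (⊤ : P) - 1 - grade ℕ v) (grade ℕ v) 1 (-1) := by
  obtain ⟨-, -, hvc, hmin⟩ := mem_chainsFrom.1 hc
  have h1 : grade ℕ u < grade ℕ v := grade_strictMono h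
  have h2 : grade ℕ v < grade ℕ (⊤ : P) := grade_strictMono hv
  rw [gapWeight_of_isLeast (s := grade ℕ v) q h1 (by omega)]
  · congr 1
    rw [show grade ℕ u + (grade ℕ (⊤ : P) - 1 - grade ℕ u) - grade ℕ v
      = grade ℕ (⊤ : P) - 1 - grade ℕ v by omega]
    refine gapWeight_congr _ _ _ _ fun i hi _ => ?_
    rw [Finset.image_insert, Finset.mem_insert, or_iff_right (by omega)]
  · exact Finset.mem_image_of_mem _ (Finset.mem_insert_of_mem hvc)
  · intro i hi hlt
    rw [Finset.image_insert, Finset.mem_insert, or_iff_right (by omega)] at hi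
    obtain ⟨w, hw, rfl⟩ := Finset.mem_image.1 hi
    exact grade_mono (hmin hw)

/-- Only the first gap sees `q`; every later one starts from `(1, -1)`. Hence the hypothesis
concerns `-1` alone, while `q` stays free to cover both polynomials. -/
theorem sum_gapWeight_eq_sum_Ioc {u : P} (h : u < ⊤)
    (ih : ∀ v, u < v → v < ⊤ → ∑ c ∈ chainsFrom v, gapWeight (c.image (grade ℕ))
      (grade ℕ (⊤ : P) - 1 - grade ℕ v) (grade ℕ v) 1 (-1) = chowInterval v ⊤) (q : ℤ[X]) :
    ∑ c ∈ chainsFrom u, gapWeight (c.image (grade ℕ))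
        (grade ℕ (⊤ : P) - 1 - grade ℕ u) (grade ℕ u) 1 q
      = 1 + ∑ v ∈ Finset.Ioc u ⊤, (X ^ (grade ℕ v - grade ℕ u) * q
          + ∑ i ∈ Finset.range (grade ℕ v - grade ℕ u), X ^ (i + 1)) * chowInterval v ⊤ := by
  rw [sum_chainsFrom h, ← Finset.insert_erase (Finset.mem_Ioc.2 ⟨h, le_rfl⟩),
    Finset.sum_insert (by simp), Finset.sum_insert (by simp), chainsFrom_top,
    Finset.sum_singleton, gapWeight_insert_top h, chowInterval_self, mul_one, add_assoc]
  congr 2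
  refine Finset.sum_congr rfl fun v hv => ?_
  have hv' := Finset.mem_erase.1 hv
  have h1 := (Finset.mem_Ioc.1 hv'.2).1
  have h2 := lt_top_iff_ne_top.2 hv'.1
  rw [← ih v h1 h2, Finset.mul_sum]
  exact Finset.sum_congr rfl fun c hc => gapWeight_insert h1 h2 hc q

theorem one_sub_X_mul_sum_pow (k : ℕ) :
    (1 - X : ℤ[X]) * (X ^ k * (-1) + ∑ i ∈ Finset.range k, X ^ (i + 1)) = X - X ^ k := by
  have h1 : ∑ i ∈ Finset.range k, (X : ℤ[X]) ^ (i + 1) = X * ∑ i ∈ Finset.range k, X ^ i := by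
    rw [Finset.mul_sum]
    exact Finset.sum_congr rfl fun _ _ => by ring
  have h2 := mul_neg_geom_sum (X : ℤ[X]) k
  rw [h1]
  linear_combination X * h2

/-- The Chow polynomials as sums over chains. -/
theorem sum_gapWeight_eq_chowInterval {u : P} (h : u < ⊤) :
    ∑ c ∈ chainsFrom u, gapWeight (c.image (grade ℕ))
        (grade ℕ (⊤ : P) - 1 - grade ℕ u) (grade ℕ u) 1 (-1) = chowInterval u ⊤ := by
  induction u using WellFoundedGT.induction with
  | ind u ih =>
  -- Multiplication by `1 - x` turns each gap factor into the coefficient `x - x^k` of the rank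
  -- recursion.
  refine mul_left_cancel₀ one_sub_X_ne_zero ?_
  rw [sum_gapWeight_eq_sum_Ioc h ih, sum_Ioc_rank_mul_chowInterval h.le, mul_add, mul_one,
    Finset.mul_sum]
  congr 1
  refine Finset.sum_congr rfl fun v _ => ?_
  rw [← mul_assoc, one_sub_X_mul_sum_pow]

theorem sum_gapWeight_eq_chowPoly (h : (⊥ : P) < ⊤) :
    ∑ c ∈ chainsFrom (⊥ : P), gapWeight (c.image (grade ℕ)) (grade ℕ (⊤ : P) - 1) 0 1 (-1)
      = chowPoly P := by
  have := sum_gapWeight_eq_chowInterval h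
  simp only [grade_bot, bot_eq_zero, Nat.sub_zero] at this
  exact this

/-- Passing from `q = -1` to `q = 0` adds `x^(rk v)` to the first gap factor, and so adds the terms
of `H^aug` with `w > ⊥` to `H`. -/
theorem sum_gapWeight_eq_augChowPoly (h : (⊥ : P) < ⊤) :
    ∑ c ∈ chainsFrom (⊥ : P), gapWeight (c.image (grade ℕ)) (grade ℕ (⊤ : P) - 1) 0 1 0
      = augChowPoly P := by
  have h0 := sum_gapWeight_eq_sum_Ioc h (fun v _ => sum_gapWeight_eq_chowInterval) 0
  have h1 := sum_gapWeight_eq_sum_Ioc h (fun v _ => sum_gapWeight_eq_chowInterval) (-1)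
  rw [sum_gapWeight_eq_chowInterval h] at h1
  simp only [grade_bot, bot_eq_zero, Nat.sub_zero] at h0 h1
  have h2 : augChowPoly P
      = chowInterval (⊥ : P) ⊤ + ∑ w ∈ Finset.Ioc (⊥ : P) ⊤, X ^ grade ℕ w * chowInterval w ⊤ := by
    have h3 : Finset.univ.erase (⊥ : P) = Finset.Ioc ⊥ ⊤ := by
      ext
      simp [bot_lt_iff_ne_bot]
    rw [augChowPoly, ← Finset.add_sum_erase _ _ (Finset.mem_univ (⊥ : P)), h3, grade_bot,
      bot_eq_zero, pow_zero, one_mul]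
  rw [h0, h2, h1, add_assoc, ← Finset.sum_add_distrib]
  congr 1
  refine Finset.sum_congr rfl fun v _ => ?_
  ring

end GapExpansion

/-! ### Flag vectors and chains with prescribed ranks -/

section FlagVectors

/-- Möbius inversion on the Boolean lattice, by induction applied both to `α` and to `R ↦ α (insert
a R)`. -/
theorem sum_powerset_alternating_sum (S : Finset ℕ) (α : Finset ℕ → ℤ) :
    ∑ T ∈ S.powerset, ∑ R ∈ T.powerset, (-1) ^ (T \ R).card * α R = α S := by
  induction S using Finset.induction_on generalizing α with
  | empty => simp
  | insert a S ha ih =>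
    rw [Finset.sum_powerset_insert ha, ih, add_comm, ← eq_sub_iff_add_eq, ← ih α,
      ← ih (fun R => α (insert a R)), ← Finset.sum_sub_distrib]
    refine Finset.sum_congr rfl fun T hT => ?_
    have haT : a ∉ T := fun h => ha (Finset.mem_powerset.1 hT h)
    rw [Finset.sum_powerset_insert haT, add_comm, sub_eq_add_neg, ← Finset.sum_neg_distrib]
    congr 1
    · refine Finset.sum_congr rfl fun R hR => ?_
      congr 3
      ext i
      simp only [Finset.mem_sdiff, Finset.mem_insert]
      have : i = a → i ∉ T := fun h => h ▸ haT
      tauto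
    · refine Finset.sum_congr rfl fun R hR => ?_
      have haR : a ∉ R := fun h => haT (Finset.mem_powerset.1 hR h)
      rw [Finset.insert_sdiff_of_notMem _ haR, Finset.card_insert_of_notMem, pow_succ]
      · ring
      · simp [haT]

theorem eq_of_le_of_grade_le {P : Type*} [PartialOrder P] [GradeOrder ℕ P] {a b : P}
    (h : a ≤ b) (hg : grade ℕ b ≤ grade ℕ a) : a = b :=
  h.eq_of_not_lt fun hlt => not_lt_of_ge hg (grade_strictMono hlt)

theorem exists_grade_eq {P : Type*} [PartialOrder P] [LocallyFiniteOrder P] [GradeOrder ℕ P]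
    {a b : P} (hab : a ≤ b) {r : ℕ} (har : grade ℕ a ≤ r) (hrb : r ≤ grade ℕ b) :
    ∃ z, a ≤ z ∧ z ≤ b ∧ grade ℕ z = r := by
  induction r, har using Nat.le_induction with
  | base => exact ⟨a, le_rfl, hab, rfl⟩
  | succ r _ ih =>
    obtain ⟨z, h1, h2, h3⟩ := ih (by omega)
    have h4 : z < b := lt_of_le_of_ne h2 fun h => by rw [h] at h3; omega
    obtain ⟨y, h5, h6⟩ := exists_covBy_le_of_lt h4
    refine ⟨y, h1.trans h5.le, h6, ?_⟩
    have := Order.covBy_iff_add_one_eq.1 (h5.grade ℕ)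
    omega

variable {P : Type*} [PartialOrder P] [BoundedOrder P] [Fintype P]
  [LocallyFiniteOrder P] [GradeMinOrder ℕ P]

/-- A chain with minimum, maximum and prescribed ranks, as a maximal chain of a rank-selected
subposet. -/
def flagOfChain {S : Finset ℕ} (c : Finset P) (hc : IsChain (· ≤ ·) (c : Set P))
    (hS : S ⊆ c.image (grade ℕ)) : Flag {w : P // grade ℕ w ∈ S} where
  carrier := {w | w.1 ∈ c}
  Chain' := fun v hv w hw h => hc hv hw fun h2 => h (Subtype.ext h2)
  max_chain' := by
    intro s hs hcs
    -- The chain already occupies every rank in `S`, and comparable elements of equal rank coincide,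
    -- so nothing can be added.
    refine Set.Subset.antisymm hcs fun w hw => ?_
    obtain ⟨v, hv, hvw⟩ := Finset.mem_image.1 (hS w.2)
    have hv' : grade ℕ v ∈ S := hvw ▸ w.2
    have hvs : (⟨v, hv'⟩ : {w : P // grade ℕ w ∈ S}) ∈ s := hcs hv
    have heq : v = w.1 := by
      rcases hs.total hvs hw with h | h
      · exact eq_of_le_of_grade_le (a := v) (b := w.1) h hvw.ge
      · exact (eq_of_le_of_grade_le (a := w.1) (b := v) h hvw.le).symm
    rwa [heq] at hv

/-- If rank `r` were missed, gradedness would supply an element of rank `r` between the neighbouring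
chain elements, contradicting maximality. -/
theorem exists_mem_flag_grade_eq {S : Finset ℕ} (hS : S ⊆ Finset.Icc 1 (grade ℕ (⊤ : P) - 1))
    (s : Flag {w : P // grade ℕ w ∈ S}) {r : ℕ} (hr : r ∈ S) : ∃ w ∈ s, grade ℕ w.1 = r := by
  classical
  by_contra! hne
  have hr' := Finset.mem_Icc.1 (hS hr)
  -- Adjoining `⊥` and `⊤` guarantees neighbours on both sides of `r`.
  let c : Finset P := Finset.univ.filter fun w =>
    w = ⊥ ∨ w = ⊤ ∨ ∃ h : grade ℕ w ∈ S, (⟨w, h⟩ : {w : P // grade ℕ w ∈ S}) ∈ s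
  have hc : ∀ v ∈ c, ∀ w ∈ c, v ≤ w ∨ w ≤ v := by
    intro v hv w hw
    simp only [c, Finset.mem_filter, Finset.mem_univ, true_and] at hv hw
    rcases hv with rfl | rfl | ⟨hv, hvs⟩
    · exact Or.inl bot_le
    · exact Or.inr le_top
    rcases hw with rfl | rfl | ⟨hw, hws⟩
    · exact Or.inr bot_le
    · exact Or.inl le_top
    exact s.le_or_le hvs hws
  have hb : (⊥ : P) ∈ c := by simp [c]
  have ht : (⊤ : P) ∈ c := by simp [c]
  have hrc : ∀ w ∈ c, grade ℕ w ≠ r := by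
    intro w hw
    simp only [c, Finset.mem_filter, Finset.mem_univ, true_and] at hw
    rcases hw with rfl | rfl | ⟨hw, hws⟩
    · rw [grade_bot, bot_eq_zero]; omega
    · omega
    · exact hne _ hws
  obtain ⟨a, ha, hamax⟩ := (c.filter fun w => grade ℕ w < r).exists_max_image (grade ℕ)
    ⟨⊥, Finset.mem_filter.2 ⟨hb, by rw [grade_bot, bot_eq_zero]; omega⟩⟩
  obtain ⟨b, hb, hbmin⟩ := (c.filter fun w => r < grade ℕ w).exists_min_image (grade ℕ)
    ⟨⊤, Finset.mem_filter.2 ⟨ht, by omega⟩⟩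
  obtain ⟨hac, har⟩ := Finset.mem_filter.1 ha
  obtain ⟨hbc, hbr⟩ := Finset.mem_filter.1 hb
  have key : ∀ v ∈ c, ∀ w ∈ c, grade ℕ v ≤ grade ℕ w → v ≤ w := by
    intro v hv w hw hvw
    rcases hc v hv w hw with h | h
    · exact h
    · rcases h.eq_or_lt with h | h
      · exact h.ge
      · exact absurd (grade_strictMono (𝕆 := ℕ) h) (not_lt_of_ge hvw)
  obtain ⟨z, haz, hzb, hz⟩ := exists_grade_eq (key a hac b hbc (by omega)) har.le hbr.le
  refine hne ⟨z, hz ▸ hr⟩ (Flag.mem_iff_forall_le_or_ge.2 ?_) hz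
  rintro ⟨w, hw⟩ hws
  have hwc : w ∈ c := by
    simp only [c, Finset.mem_filter, Finset.mem_univ, true_and]
    exact Or.inr (Or.inr ⟨hw, hws⟩)
  rcases lt_or_gt_of_ne (hrc w hwc) with h | h
  · right
    exact (key w hwc a hac (hamax w (Finset.mem_filter.2 ⟨hwc, h⟩))).trans haz
  · left
    exact hzb.trans (key b hbc w hwc (hbmin w (Finset.mem_filter.2 ⟨hwc, h⟩)))

/-- The bijection forgets `⊥` and `⊤`, the only elements of such a chain whose ranks lie outside
`S`; its inverse adjoins them. -/
theorem flagF_eq_card_chainsFrom {S : Finset ℕ} (hbt : (⊥ : P) < ⊤)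
    (hS : S ⊆ Finset.Icc 1 (grade ℕ (⊤ : P) - 1)) :
    flagF P S = ((chainsFrom (⊥ : P)).filter fun c =>
      c.image (grade ℕ) ∩ Finset.Icc 1 (grade ℕ (⊤ : P) - 1) = S).card := by
  classical
  let A := (chainsFrom (⊥ : P)).filter fun c =>
    c.image (grade ℕ) ∩ Finset.Icc 1 (grade ℕ (⊤ : P) - 1) = S
  have hA : ∀ c ∈ A, IsChain (· ≤ ·) (c : Set P) ∧ S ⊆ c.image (grade ℕ) := by
    intro c hc
    obtain ⟨h1, h2⟩ := Finset.mem_filter.1 hc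
    exact ⟨(mem_chainsFrom.1 h1).1, h2 ▸ Finset.inter_subset_left⟩
  let f : A → Flag {w : P // grade ℕ w ∈ S} := fun c =>
    flagOfChain c.1 (hA c.1 c.2).1 (hA c.1 c.2).2
  have hbot : ∀ {w : P}, grade ℕ w = 0 → w = ⊥ := fun {w} h =>
    (eq_of_le_of_grade_le bot_le (by rw [h]; exact Nat.zero_le _)).symm
  have hmem : ∀ c ∈ A, ∀ w : P, w ∈ c ↔ w = ⊥ ∨ w = ⊤ ∨ (w ∈ c ∧ grade ℕ w ∈ S) := by
    intro c hc w
    obtain ⟨h1, h2⟩ := Finset.mem_filter.1 hc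
    obtain ⟨-, h3, h4, -⟩ := mem_chainsFrom.1 h1
    constructor
    · intro hw
      by_cases hw0 : w = ⊥
      · exact Or.inl hw0
      by_cases hw1 : w = ⊤
      · exact Or.inr (Or.inl hw1)
      have h5 : grade ℕ w < grade ℕ (⊤ : P) := grade_strictMono (lt_top_iff_ne_top.2 hw1)
      have h6 : grade ℕ w ≠ 0 := fun h => hw0 (hbot h)
      refine Or.inr (Or.inr ⟨hw, h2 ▸ Finset.mem_inter.2 ⟨Finset.mem_image_of_mem _ hw, ?_⟩⟩)
      rw [Finset.mem_Icc]
      omega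
    · rintro (rfl | rfl | h)
      · exact h4
      · exact h3
      · exact h.1
  have hf : Function.Bijective f := by
    constructor
    · rintro ⟨c, hc⟩ ⟨d, hd⟩ hcd
      have h1 : ∀ w : P, grade ℕ w ∈ S → (w ∈ c ↔ w ∈ d) := fun w h =>
        iff_of_eq (congrArg (fun s : Flag {w : P // grade ℕ w ∈ S} =>
          (⟨w, h⟩ : {w : P // grade ℕ w ∈ S}) ∈ s) hcd)
      refine Subtype.ext (Finset.ext fun w => ?_)
      rw [hmem c hc, hmem d hd]
      have := h1 w
      tauto
    · intro s
      let c : Finset P := Finset.univ.filter fun w =>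
        w = ⊥ ∨ w = ⊤ ∨ ∃ h : grade ℕ w ∈ S, (⟨w, h⟩ : {w : P // grade ℕ w ∈ S}) ∈ s
      have hcm : ∀ w, w ∈ c ↔ w = ⊥ ∨ w = ⊤ ∨
          ∃ h : grade ℕ w ∈ S, (⟨w, h⟩ : {w : P // grade ℕ w ∈ S}) ∈ s := by
        simp [c]
      have hc : c ∈ A := by
        refine Finset.mem_filter.2 ⟨mem_chainsFrom.2 ⟨?_, (hcm _).2 (Or.inr (Or.inl rfl)),
          (hcm _).2 (Or.inl rfl), fun _ _ => bot_le⟩, ?_⟩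
        · intro v hv w hw _
          rcases (hcm v).1 hv with rfl | rfl | ⟨hv, hvs⟩
          · exact Or.inl bot_le
          · exact Or.inr le_top
          rcases (hcm w).1 hw with rfl | rfl | ⟨hw, hws⟩
          · exact Or.inr bot_le
          · exact Or.inl le_top
          exact s.le_or_le hvs hws
        · ext r
          rw [Finset.mem_inter, Finset.mem_image]
          constructor
          · rintro ⟨⟨w, hw, rfl⟩, hr⟩
            rw [Finset.mem_Icc] at hr
            rcases (hcm w).1 hw with rfl | rfl | ⟨hw, -⟩
            · rw [grade_bot, bot_eq_zero] at hr; omega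
            · omega
            · exact hw
          · intro hr
            obtain ⟨w, hw, rfl⟩ := exists_mem_flag_grade_eq hS s hr
            exact ⟨⟨w.1, (hcm _).2 (Or.inr (Or.inr ⟨w.2, hw⟩)), rfl⟩, hS hr⟩
      refine ⟨⟨c, hc⟩, Flag.ext (Set.ext fun w => ?_)⟩
      change w.1 ∈ c ↔ w ∈ s
      rw [hcm]
      constructor
      · rintro (h | h | ⟨_, h⟩)
        · have := Finset.mem_Icc.1 (hS w.2)
          rw [h, grade_bot, bot_eq_zero] at this
          omega
        · have := Finset.mem_Icc.1 (hS w.2)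
          have h0 : grade ℕ (⊥ : P) < grade ℕ (⊤ : P) := grade_strictMono hbt
          rw [h] at this
          omega
        · exact h
      · intro h
        exact Or.inr (Or.inr ⟨w.2, h⟩)
  rw [flagF, ← Nat.card_eq_of_bijective f hf, Nat.card_eq_fintype_card, Fintype.card_coe]

end FlagVectors

/-! ### The γ-expansions and γ-positivity -/

section GammaExpansion

variable {P : Type*} [PartialOrder P] [BoundedOrder P] [Fintype P] [DecidableEq P]
  [LocallyFiniteOrder P] [GradeMinOrder ℕ P]

theorem sum_powerset_flagH (S : Finset ℕ) : ∑ T ∈ S.powerset, flagH P T = flagF P S :=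
  sum_powerset_alternating_sum S fun S => (flagF P S : ℤ)

/-- Grouping chains by rank set produces `α(S)`; expanding it in `β` and exchanging the sums
collects all `S ⊇ T` for each `T`. -/
theorem sum_gapWeight_eq_sum_flagH (m : ℕ) (hm : grade ℕ (⊤ : P) = m + 1) (q : ℤ[X]) :
    ∑ c ∈ chainsFrom (⊥ : P), gapWeight (c.image (grade ℕ)) m 0 1 q
      = ∑ T ∈ (Finset.Icc 1 m).powerset, C (flagH P T) * upperGapWeight T m 0 1 q := by
  have hbt := bot_lt_top_of_one_le_grade (P := P) (by omega)
  have h1 : ∑ c ∈ chainsFrom (⊥ : P), gapWeight (c.image (grade ℕ)) m 0 1 q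
      = ∑ S ∈ (Finset.Icc 1 m).powerset, (flagF P S : ℤ[X]) * gapWeight S m 0 1 q := by
    rw [← Finset.sum_fiberwise_of_maps_to (g := fun c => c.image (grade ℕ) ∩ Finset.Icc 1 m)
      (t := (Finset.Icc 1 m).powerset)
      (fun c _ => Finset.mem_powerset.2 Finset.inter_subset_right)]
    refine Finset.sum_congr rfl fun S hS => ?_
    rw [flagF_eq_card_chainsFrom hbt (by simpa [hm] using hS), hm, Nat.add_sub_cancel,
      ← nsmul_eq_mul]
    refine Finset.sum_eq_card_nsmul fun c hc => ?_
    refine gapWeight_congr _ _ _ _ fun i h1 h2 => ?_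
    rw [← (Finset.mem_filter.1 hc).2, Finset.mem_inter, Finset.mem_Icc]
    exact ⟨fun h => ⟨h, by omega⟩, fun h => h.1⟩
  rw [h1]
  have h2 : ∀ S : Finset ℕ, (flagF P S : ℤ[X]) = ∑ T ∈ S.powerset, C (flagH P T) := by
    intro S
    rw [← map_sum, sum_powerset_flagH]
    simp
  simp only [h2, Finset.sum_mul, upperGapWeight, Finset.mul_sum]
  refine Finset.sum_comm' fun S T => ?_
  simp only [Finset.mem_powerset, Finset.mem_filter, zero_add]
  constructor
  · rintro ⟨h3, h4⟩
    exact ⟨⟨h3, h4⟩, h4.trans h3⟩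
  · rintro ⟨⟨h3, h4⟩, -⟩
    exact ⟨h3, h4⟩

theorem augChowPoly_gamma_expansion :
    augChowPoly P = ∑ T ∈ isolatedSubsets (Finset.Icc 1 (grade ℕ (⊤ : P) - 1)),
      C (flagH P T) * X ^ T.card * (1 + X) ^ (grade ℕ (⊤ : P) - 2 * T.card) := by
  rcases Nat.eq_zero_or_eq_succ_pred (grade ℕ (⊤ : P)) with h | h
  -- Rank zero: `P` is a point, and the only summand is `β(∅) = 1`.
  · have hbt : (⊤ : P) = ⊥ := (eq_of_le_of_grade_le bot_le (by rw [h]; exact Nat.zero_le _)).symm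
    have hF : flagF P ∅ = 1 := by
      have : IsEmpty {w : P // grade ℕ w ∈ (∅ : Finset ℕ)} := ⟨fun w => by simpa using w.2⟩
      rw [flagF, Nat.card_eq_one_iff_unique]
      refine ⟨⟨fun s t => Flag.ext (Set.ext fun w => isEmptyElim w)⟩, ⟨⟨∅, ?_, ?_⟩⟩⟩
      · simp
      · intro s _ _
        exact (Set.eq_empty_of_isEmpty s).symm
    have hu : (Finset.univ : Finset P) = {⊤} := by
      ext w
      simp only [Finset.mem_univ, Finset.mem_singleton, true_iff]
      exact le_antisymm le_top (hbt ▸ bot_le)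
    rw [augChowPoly, hu, Finset.sum_singleton, h, chowInterval_self]
    simp [isolatedSubsets, flagH, hF, Finset.filter_singleton]
  · set m := (grade ℕ (⊤ : P)).pred
    have h1 := sum_gapWeight_eq_augChowPoly (bot_lt_top_of_one_le_grade (P := P) (by omega))
    rw [h, Nat.succ_sub_one, sum_gapWeight_eq_sum_flagH m h] at h1
    rw [← h1, h, Nat.succ_sub_one, isolatedSubsets, Finset.sum_filter]
    refine Finset.sum_congr rfl fun T hT => ?_
    rw [upperGapWeight_one_zero m (Finset.mem_powerset.1 hT)]
    split_ifs
    · rw [mul_assoc]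
    · rw [mul_zero]

theorem chowPoly_gamma_expansion (h1 : 1 ≤ grade ℕ (⊤ : P)) :
    chowPoly P = ∑ T ∈ isolatedSubsets (Finset.Icc 2 (grade ℕ (⊤ : P) - 1)),
      C (flagH P T) * X ^ T.card * (1 + X) ^ (grade ℕ (⊤ : P) - 1 - 2 * T.card) := by
  obtain ⟨m, h⟩ := Nat.exists_eq_add_of_le' h1
  have h2 := sum_gapWeight_eq_chowPoly (bot_lt_top_of_one_le_grade h1)
  rw [h, Nat.add_sub_cancel, sum_gapWeight_eq_sum_flagH m h] at h2
  have h3 : isolatedSubsets (Finset.Icc 2 m) = (Finset.Icc 1 m).powerset.filter fun T =>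
      (∀ i ∈ T, i + 1 ∉ T) ∧ 1 ∉ T := by
    ext T
    simp only [isolatedSubsets, Finset.mem_filter, Finset.mem_powerset]
    constructor
    · rintro ⟨hT, hi⟩
      exact ⟨hT.trans (Finset.Icc_subset_Icc_left (by omega)), hi, fun h => by simpa using hT h⟩
    · rintro ⟨hT, hi, hT1⟩
      refine ⟨fun i hiT => ?_, hi⟩
      have h3 := Finset.mem_Icc.1 (hT hiT)
      have h4 : i ≠ 1 := fun h => hT1 (h ▸ hiT)
      rw [Finset.mem_Icc]
      omega
  rw [← h2, h, Nat.add_sub_cancel, h3, Finset.sum_filter]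
  refine Finset.sum_congr rfl fun T hT => ?_
  rw [upperGapWeight_one_neg_one m (Finset.mem_powerset.1 hT)]
  split_ifs
  · rw [mul_assoc]
  · rw [mul_zero]

theorem isGammaPositive_sum {d : ℕ} {A : Finset (Finset ℕ)} {f : Finset ℕ → ℤ}
    (hA : ∀ T ∈ A, 2 * T.card ≤ d) (hf : ∀ T ∈ A, 0 ≤ f T) :
    IsGammaPositive d (∑ T ∈ A, C (f T) * X ^ T.card * (1 + X) ^ (d - 2 * T.card)) := by
  refine ⟨fun i => ∑ T ∈ A with T.card = i, f T, fun i =>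
    Finset.sum_nonneg fun T hT => hf T (Finset.mem_filter.1 hT).1, ?_⟩
  rw [← Finset.sum_fiberwise_of_maps_to (g := Finset.card) (t := Finset.range (d / 2 + 1))
    (fun T hT => Finset.mem_range.2 (by have := hA T hT; omega))]
  refine Finset.sum_congr rfl fun i _ => ?_
  rw [map_sum, Finset.sum_mul, Finset.sum_mul]
  exact Finset.sum_congr rfl fun T hT => by rw [(Finset.mem_filter.1 hT).2]

/-- The condition `hd` bounds the maximal size of an isolated subset of `[a, b]`, so that no
exponent `d - 2|T|` is truncated. -/
theorem isGammaPositive_isolatedSubsets {a b d : ℕ} {f : Finset ℕ → ℤ} (hd : b + 2 ≤ d + a)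
    (hf : ∀ T ⊆ Finset.Icc a b, 0 ≤ f T) :
    IsGammaPositive d (∑ T ∈ isolatedSubsets (Finset.Icc a b),
      C (f T) * X ^ T.card * (1 + X) ^ (d - 2 * T.card)) := by
  refine isGammaPositive_sum (fun T hT => ?_) (fun T hT => ?_) <;>
    obtain ⟨h1, h2⟩ := Finset.mem_filter.1 hT
  · have := two_mul_card_le_of_isolated (Finset.mem_powerset.1 h1) h2
    omega
  · exact hf T (Finset.mem_powerset.1 h1)

end GammaExpansion

theorem corollary2p4 {P : Type*} [PartialOrder P] [BoundedOrder P] [Fintype P] [DecidableEq P]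
    [LocallyFiniteOrder P] [GradeMinOrder ℕ P] (n : ℕ) (hn : grade ℕ (⊤ : P) = n) :
    -- the two polynomials are the specializations of the extended ab-index
    ((1 - X) ^ n * augChowPoly P = abEval (extendedABIndex P)) ∧
    (1 ≤ n → (1 - X) ^ n * chowPoly P = abEval (removeInitial (extendedABIndex P))) ∧
    -- the γ-expansions
    (augChowPoly P = ∑ T ∈ isolatedSubsets (Finset.Icc 1 (n - 1)),
      C (flagH P T) * X ^ T.card * (1 + X) ^ (n - 2 * T.card)) ∧
    (1 ≤ n → chowPoly P = ∑ T ∈ isolatedSubsets (Finset.Icc 2 (n - 1)),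
      C (flagH P T) * X ^ T.card * (1 + X) ^ (n - 1 - 2 * T.card)) ∧
    -- γ-positivity
    ((∀ T ⊆ Finset.Icc 1 (n - 1), 0 ≤ flagH P T) →
      IsGammaPositive n (augChowPoly P) ∧ (1 ≤ n → IsGammaPositive (n - 1) (chowPoly P))) := by
  subst hn
  refine ⟨one_sub_pow_mul_augChowPoly, one_sub_pow_mul_chowPoly, augChowPoly_gamma_expansion,
    chowPoly_gamma_expansion, fun hpos => ⟨?_, fun h => ?_⟩⟩
  · rw [augChowPoly_gamma_expansion]
    -- At rank zero the truncated `n - 1` is `0`, which violates the numerical bound although the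
    -- interval `[1, 0]` is empty.
    rcases Nat.eq_zero_or_pos (grade ℕ (⊤ : P)) with h | h
    · rw [h] at hpos ⊢
      refine isGammaPositive_sum (fun T hT => ?_) fun T hT =>
        hpos T (Finset.mem_powerset.1 (Finset.mem_filter.1 hT).1)
      have := Finset.mem_powerset.1 (Finset.mem_filter.1 hT).1
      simpa using this
    · exact isGammaPositive_isolatedSubsets (by omega) hpos
  · rw [chowPoly_gamma_expansion h]
    exact isGammaPositive_isolatedSubsets (by omega) fun T hT =>
      hpos T (hT.trans (Finset.Icc_subset_Icc_left (by omega)))
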